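/- Let $r\ge 256$ be the data length and $0<\epsilon\le 2^{-4}$. Put $n=\lceil 3\log_2(16/\epsilon)\rceil$, $l=\lceil\log_2 r\rceil$, $N=2n$, $l_{\rm sc}=4nl+16(n+l)$. Primitives. Let $f:\{0,1\}^l\times\{0,1\}^r\to\{0,1\}^l$ be a hash function with $\Pr_K[f(K,m)=f(K,m')]\le\lceil r/l-1\rceil 2^{-l}$ for all $m\ne m'$ and uniform $K$. For each message length $r'$ let a message authentication code (MAC) with $2(n+l)$-bit keys and $(n+l)$-bit tags be given for which anyone who sees the tag of one message under a uniform key can produce a correctly tagged different message with probability at most $\lceil r'/(n+l)\rceil 2^{-(n+l)}$. Such primitives exist. Protocol. Alice ($A$), Bob ($B$) and a trusted third party (TTP) communicate over unauthenticated public channels. (1) Key distribution. The TTP chooses uniformly a set $\Omega\subset\{1,\dots,N\}$ with $n$ elements and keys $k^A_j,k^B_j\in\{0,1\}^l$ ($1\le j\le N$) subject to $k^A_j=k^B_j$ for $j\in\Omega$, and for each player an independent uniform one-time pad of $Nl$ bits and four independent uniform MAC keys of $2(n+l)$ bits, one for each of the four messages between this player and the TTP. He gives each player that player's keys and keeps $\Omega$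 secret. (2) Equality testing. Player $X$ with data $m^X$ sends the one-time pad encryption of the hash values $s^X_j=f(k^X_j,m^X)$, $1\le j\le N$, with a MAC tag. The TTP announces "success" if both tags are valid and the decrypted values satisfy $s^A_j=s^B_j$ for all $j\in\Omega$, and "failure" otherwise. (3) Dispute resolution (after a success). The players send their claimed data $m^{A*},m^{B*}$ with MAC tags. If a tag is invalid, no verdict is given. Otherwise let $g^{\alpha\beta}=|\{j: f(k^\alpha_j,m^{\beta*})=s^\alpha_j\}|$ for $\alpha,\beta\in\{A,B\}$. The TTP announces "both are correct" if $m^{A*}=m^{B*}$; otherwise "$m^{A*}$ is correct" if $g^{AA}=N$ and ($g^{BA}>g^{AB}$ or $g^{BB}<N$); otherwise "$m^{B*}$ is correct" if the same holds with $A,B$ exchanged; otherwise "undecidable". Announcements are sent to both players as 2-bit messages with MAC tags. Then the protocol is $\epsilon$-secure, that is: - Soundness: if both players are honest, $m^A=m^B$, and the channels are undisturbed, the equality-testing phase always succeeds. - $\epsilon$-unmodifiability: if Alice is honest with arbitrary data $m^A$, then for every (randomized, computationally unbounded) strategy of Bob, who knows $m^A$ and his keys, reads all channels and decides adaptively what reaches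 the TTP in either player's name, the probability that the TTP announces "success" and afterwards "$m^{B*}$ is correct" or "undecidable" is at most $\epsilon$; and the same holds with the roles of Alice and Bob exchanged. The secure communication keys (pads and MAC keys) of the two players have total length $l_{\rm sc}$, and all secret keys have total length $8(nl+2n+2l)$ bits. When both players follow the protocol over undisturbed channels, the equality-testing phase uses exactly $4(nl+n+l+1)$ bits of communication, which is at most $4(nl+2n+2l+1)$, and the dispute-resolution phase exactly $2(r+2n+2l+2)$ bits, which is at most $2(r+4n+4l+2)$. -/

import Mathlib

/-- Bit strings of length `k`. -/
abbrev Bits (k : ℕ) : Type := Fin k → Bool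

/-- Bitwise exclusive or. -/
def Bits.xor {k : ℕ} (x y : Bits k) : Bits k := fun i => Bool.xor (x i) (y i)

/-- A vector of `N` blocks of `l` bits, written as one string of `N * l` bits. -/
def flatten {N l : ℕ} (s : Fin N → Bits l) : Bits (N * l) :=
  fun i => s (finProdFinEquiv.symm i).1 (finProdFinEquiv.symm i).2

/-- Cut a string of `N * l` bits into `N` blocks of `l` bits (the inverse of `flatten`). -/
def unflatten {N l : ℕ} (x : Bits (N * l)) : Fin N → Bits l :=
  fun j i => x (finProdFinEquiv (j, i))

/-- `f` is `δ`-almost universal: for distinct `m`, `m'`, a uniformly random key makes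
`f k m = f k m'` with probability at most `δ`. -/
def IsAlmostUniversal {a r b : ℕ} (f : Bits a → Bits r → Bits b) (δ : ℝ) : Prop :=
  ∀ m m' : Bits r, m ≠ m' →
    ((Finset.univ.filter fun k : Bits a => f k m = f k m').card : ℝ) / 2 ^ a ≤ δ

/-- `g` is a `δ`-secure one-time message authentication code: for every message `m`, a forger who
sees the tag `g k m` under a uniformly random key `k` outputs a correctly tagged message other than
`m` with probability at most `δ`. The forger has unlimited computing power. -/
def IsSecureMAC {a L t : ℕ} (g : Bits a → Bits L → Bits t) (δ : ℝ) : Prop :=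
  ∀ (m : Bits L) (F : Bits t → Bits L × Bits t),
    ((Finset.univ.filter fun k : Bits a =>
      (F (g k m)).1 ≠ m ∧ g k (F (g k m)).1 = (F (g k m)).2).card : ℝ) / 2 ^ a ≤ δ

/-- The two players, Alice and Bob. -/
inductive Player
  | A
  | B
  deriving DecidableEq

instance : Fintype Player := ⟨{.A, .B}, fun X => by cases X <;> simp⟩

/-- The other player. -/
def Player.other : Player → Player
  | .A => .B
  | .B => .A

/-- The four messages exchanged between one player and the TTP: the player's message and the TTP's
announcement in the equality-testing phase, and the same in the dispute-resolution phase. -/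
inductive Round
  | et
  | etAnn
  | dr
  | drAnn
  deriving DecidableEq

instance : Fintype Round := ⟨{.et, .etAnn, .dr, .drAnn}, fun X => by cases X <;> simp⟩

/-- Parameters: data length `r`, size `n` of the hidden subset, number `N` of equality-testing
keys per player, length `l` of each of these keys and of each hash value. -/
structure Params where
  r : ℕ
  n : ℕ
  N : ℕ
  l : ℕ
  n_le_N : n ≤ N

/-- The secure communication key of one player: the one-time pad for her hash values, and one MAC
key for each of the four messages. -/
structure ScKey (P : Params) where
  pad : Bits (P.N * P.l)
  mac : Round → Bits (2 * (P.n + P.l))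
  deriving DecidableEq, Fintype

/-- The secret keys of one player. -/
structure PlayerKey (P : Params) where
  et : Fin P.N → Bits P.l
  sc : ScKey P
  deriving DecidableEq, Fintype

/-- The equality-testing key as a bit string. -/
def PlayerKey.etBits {P : Params} (k : PlayerKey P) : List Bool := List.ofFn (flatten k.et)

/-- The secure communication key as a bit string. -/
def PlayerKey.scBits {P : Params} (k : PlayerKey P) : List Bool :=
  List.ofFn k.sc.pad ++ List.ofFn (k.sc.mac .et) ++ List.ofFn (k.sc.mac .etAnn)
    ++ List.ofFn (k.sc.mac .dr) ++ List.ofFn (k.sc.mac .drAnn)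

/-- The outcomes of the key-distribution phase: the hidden set `Ω` of exactly `n` indices, and keys
for both players whose equality-testing keys agree on `Ω`. -/
abbrev KeyMaterial (P : Params) : Type :=
  {x : Finset (Fin P.N) × (Player → PlayerKey P) //
    x.1.card = P.n ∧ ∀ j ∈ x.1, (x.2 .A).et j = (x.2 .B).et j}

/-- The hidden index set, known to the TTP only. -/
def KeyMaterial.hidden {P : Params} (K : KeyMaterial P) : Finset (Fin P.N) := K.1.1

/-- The keys of player `X`, known to `X` and to the TTP. -/
def KeyMaterial.key {P : Params} (K : KeyMaterial P) (X : Player) : PlayerKey P := K.1.2 X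

instance (P : Params) : Nonempty (KeyMaterial P) := by
  obtain ⟨s, -, hs⟩ := Finset.exists_subset_card_eq
    (s := (Finset.univ : Finset (Fin P.N))) (n := P.n) (by simpa using P.n_le_N)
  exact ⟨⟨(s, fun _ => ⟨fun _ _ => false, ⟨fun _ => false, fun _ _ => false⟩⟩), hs, by simp⟩⟩

/-- Key distribution: uniform over all admissible outcomes. As every `Ω` admits equally many key
tuples, `Ω` is uniform, the keys of either player are uniform and independent of `Ω`, and outside
`Ω` the equality-testing keys of the two players are independent. -/
noncomputable def keyDistribution (P : Params) : PMF (KeyMaterial P) :=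
  PMF.uniformOfFintype (KeyMaterial P)

/-- What is sent on a channel: a message of `L` bits and its authentication tag. -/
abbrev Packet (P : Params) (L : ℕ) : Type := Bits L × Bits (P.n + P.l)

/-- The bits on the channel. -/
def Packet.bits {P : Params} {L : ℕ} (p : Packet P L) : List Bool :=
  List.ofFn p.1 ++ List.ofFn p.2

/-- Final announcements of the TTP: both data are correct, only the data of the given player are
correct, or undecidable. -/
inductive Verdict
  | both
  | correct (X : Player)
  | undecidable
  deriving DecidableEq

/-- Two-bit encoding of the announcement of the equality-testing phase (`true` is success). -/
def encodeResult : Bool → Bits 2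
  | true => ![true, true]
  | false => ![false, false]

/-- Two-bit encoding of the announcement of the dispute-resolution phase. -/
def encodeVerdict : Verdict → Bits 2
  | .both => ![true, true]
  | .correct .A => ![true, false]
  | .correct .B => ![false, true]
  | .undecidable => ![false, false]

/-- The verdicts that are unfavorable to player `X`. -/
def Verdict.unfavorableTo (X : Player) (v : Verdict) : Prop :=
  v = .correct X.other ∨ v = .undecidable

/-- The hash function and the message authentication codes (one for each message length) with
which the protocol is run. -/
structure Primitives (P : Params) where
  hash : Bits P.l → Bits P.r → Bits P.l
  mac : (L : ℕ) → Bits (2 * (P.n + P.l)) → Bits L → Bits (P.n + P.l)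

namespace Primitives

variable {P : Params} (S : Primitives P)

/-- The requirements on the primitives: `hash` is almost universal with the collision probability
of polynomial hashing, and `mac L` is secure with the forgery probability of the polynomial
one-time MAC. -/
def Admissible : Prop :=
  IsAlmostUniversal S.hash ((⌈(P.r : ℝ) / P.l - 1⌉ : ℝ) * (2 : ℝ)⁻¹ ^ P.l) ∧
  ∀ L : ℕ, IsSecureMAC (S.mac L)
    ((⌈(L : ℝ) / ((P.n : ℝ) + P.l)⌉ : ℝ) * (2 : ℝ)⁻¹ ^ (P.n + P.l))

/-- Attach the tag to a message. -/
def sign {L : ℕ} (k : Bits (2 * (P.n + P.l))) (x : Bits L) : Packet P L := (x, S.mac L k x)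

/-- The tag of a received packet is correct. -/
def Verifies {L : ℕ} (k : Bits (2 * (P.n + P.l))) (p : Packet P L) : Prop :=
  S.mac L k p.1 = p.2

/-- Equality testing, an honest player: hash the data under all `N` keys, encrypt the hash values
with the one-time pad, authenticate. -/
def etMessage (k : PlayerKey P) (m : Bits P.r) : Packet P (P.N * P.l) :=
  S.sign (k.sc.mac .et) (Bits.xor (flatten fun j => S.hash (k.et j) m) k.sc.pad)

/-- Dispute resolution, an honest player: send the data, authenticated. -/
def drMessage (k : PlayerKey P) (m : Bits P.r) : Packet P P.r :=
  S.sign (k.sc.mac .dr) m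

/-- The hash values of player `X` that the TTP decrypts from the received packets. -/
def receivedHashes (K : KeyMaterial P) (p : Player → Packet P (P.N * P.l)) (X : Player) :
    Fin P.N → Bits P.l :=
  unflatten (Bits.xor (p X).1 (K.key X).sc.pad)

open Classical in
/-- Equality testing, the TTP: success if both received packets are authentic and the hash values
of the two players agree on the hidden set; otherwise failure. -/
noncomputable def etResult (K : KeyMaterial P) (p : Player → Packet P (P.N * P.l)) : Bool :=
  decide ((∀ X, S.Verifies ((K.key X).sc.mac .et) (p X)) ∧
    ∀ j ∈ K.hidden, receivedHashes K p .A j = receivedHashes K p .B j)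

/-- The announcement of the equality-testing phase, as sent to player `X`. -/
def etAnnouncement (K : KeyMaterial P) (b : Bool) (X : Player) : Packet P 2 :=
  S.sign ((K.key X).sc.mac .etAnn) (encodeResult b)

/-- The number of indices `j` for which the hash of the data `m β` under the `j`-th key of `α` is
the `j`-th hash value `s α j` received from `α` in the equality-testing phase. -/
def matchCount (K : KeyMaterial P) (s : Player → Fin P.N → Bits P.l) (m : Player → Bits P.r)
    (α β : Player) : ℕ :=
  (Finset.univ.filter fun j : Fin P.N => S.hash ((K.key α).et j) (m β) = s α j).card

/-- The condition under which the TTP declares the data of `X` to be correct. -/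
def Prevails (K : KeyMaterial P) (s : Player → Fin P.N → Bits P.l) (m : Player → Bits P.r)
    (X : Player) : Prop :=
  S.matchCount K s m X X = P.N ∧
    (S.matchCount K s m X.other X > S.matchCount K s m X X.other ∨
      S.matchCount K s m X.other X.other < P.N)

open Classical in
/-- Arbitration by the TTP, from the recorded hash values `s` and the claimed data `m`. -/
noncomputable def arbitrate (K : KeyMaterial P) (s : Player → Fin P.N → Bits P.l)
    (m : Player → Bits P.r) : Verdict :=
  if m .A = m .B then .both
  else if S.Prevails K s m .A then .correct .A
  else if S.Prevails K s m .B then .correct .B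
  else .undecidable

open Classical in
/-- Dispute resolution, the TTP: arbitrate if both received packets are authentic. Otherwise no
verdict is announced (anyone could have tampered with the public channels). -/
noncomputable def drResult (K : KeyMaterial P) (p : Player → Packet P (P.N * P.l))
    (q : Player → Packet P P.r) : Option Verdict :=
  if ∀ X, S.Verifies ((K.key X).sc.mac .dr) (q X) then
    some (S.arbitrate K (receivedHashes K p) fun X => (q X).1)
  else none

/-- The announcement of the dispute-resolution phase, as sent to player `X`. -/
def drAnnouncement (K : KeyMaterial P) (v : Verdict) (X : Player) : Packet P 2 :=
  S.sign ((K.key X).sc.mac .drAnn) (encodeVerdict v)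

/-- All bit strings sent in the equality-testing phase when both players follow the protocol with
data `m .A` and `m .B` and the channels are undisturbed. -/
noncomputable def etTranscript (K : KeyMaterial P) (m : Player → Bits P.r) : List (List Bool) :=
  let p : Player → Packet P (P.N * P.l) := fun X => S.etMessage (K.key X) (m X)
  let b := S.etResult K p
  [Packet.bits (p .A), Packet.bits (p .B),
    Packet.bits (S.etAnnouncement K b .A), Packet.bits (S.etAnnouncement K b .B)]

/-- All bit strings sent in the dispute-resolution phase when the channels are undisturbed and the
players, who used data `m` in the equality-testing phase, now claim data `m'`. -/
noncomputable def drTranscript (K : KeyMaterial P) (m m' : Player → Bits P.r) :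
    List (List Bool) :=
  let p : Player → Packet P (P.N * P.l) := fun X => S.etMessage (K.key X) (m X)
  let q : Player → Packet P P.r := fun X => S.drMessage (K.key X) (m' X)
  [Packet.bits (q .A), Packet.bits (q .B)] ++
    match S.drResult K p q with
    | some v => [Packet.bits (S.drAnnouncement K v .A), Packet.bits (S.drAnnouncement K v .B)]
    | none => []

/-- The number of bits sent in the equality-testing phase. -/
noncomputable def etCommunication (K : KeyMaterial P) (m : Player → Bits P.r) : ℕ :=
  (S.etTranscript K m).flatten.length

/-- The number of bits sent in the dispute-resolution phase. -/
noncomputable def drCommunication (K : KeyMaterial P) (m m' : Player → Bits P.r) : ℕ :=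
  (S.drTranscript K m m').flatten.length

end Primitives

/-- A (deterministic) strategy of a malicious player, who also controls all the public channels and
has unlimited computing power. In each phase the player sees everything sent so far, including the
packet which the honest player sends in that phase, and decides which packets reach the TTP
in the name of Alice and of Bob. Suppressing a packet is no better than replacing it by one that
is rejected. The last argument of `dr` is the honest player's packet of that phase, the one
before it the pair of announcements of the equality-testing phase. -/
structure Strategy (P : Params) where
  et : PlayerKey P → Packet P (P.N * P.l) → (Player → Packet P (P.N * P.l))
  dr : PlayerKey P → Packet P (P.N * P.l) → (Player → Packet P 2) → Packet P P.r →
    (Player → Packet P P.r)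

namespace Primitives

variable {P : Params} (S : Primitives P)

/-- An execution in which player `X` is honest with data `m` and the other player follows `σ`.
The result is what the TTP announces: success or failure of the equality-testing phase, and, after
a success, the verdict of the dispute-resolution phase (if any). -/
noncomputable def run (X : Player) (m : Bits P.r) (K : KeyMaterial P) (σ : Strategy P) :
    Bool × Option Verdict :=
  let c := S.etMessage (K.key X) m
  let p := σ.et (K.key X.other) c
  let b := S.etResult K p
  let d := S.drMessage (K.key X) m
  let q := σ.dr (K.key X.other) c (S.etAnnouncement K b) d
  (b, if b = true then S.drResult K p q else none)

/-- The distribution of the announcements when the keys are distributed by the TTP and the malicious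
player independently follows the randomized strategy `σ`. -/
noncomputable def game (X : Player) (m : Bits P.r) (σ : PMF (Strategy P)) :
    PMF (Bool × Option Verdict) :=
  (keyDistribution P).bind fun K => σ.map fun τ => S.run X m K τ

/-- Soundness: if both players are honest and hold the same data, and the channels are undisturbed,
then the equality-testing phase always succeeds. -/
def Sound : Prop :=
  ∀ (K : KeyMaterial P) (m : Bits P.r), S.etResult K (fun X => S.etMessage (K.key X) m) = true

/-- `ε`-unmodifiability: whichever player `X` is honest, whatever the data and whatever the strategy
of the other player, the probability that the TTP announces success in the equality-testing phase
and then a verdict unfavorable to `X` is at most `ε`. -/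
def Unmodifiable (ε : ℝ) : Prop :=
  ∀ (X : Player) (m : Bits P.r) (σ : PMF (Strategy P)),
    (S.game X m σ).toOuterMeasure
      {o | o.1 = true ∧ ∃ v, o.2 = some v ∧ v.unfavorableTo X} ≤ ENNReal.ofReal ε

/-- `ε`-security of the protocol. -/
def Secure (ε : ℝ) : Prop := S.Sound ∧ S.Unmodifiable ε

end Primitives

/-! Fix a deterministic strategy of the malicious player `Y` against the honest player `X` with data
`m`; a randomized one is an average of these. If `Y` wins, then either a packet received in the name
of `X` is a forgery in one of the two phases, or both carry what `X` sent. With all keys but one MAC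
key of `X` fixed, the strategy is a forger for the given MAC, so each kind of forgery has
probability at most `2⁻ⁿ` (`card_etForged_le`, `card_drForged_le`).

For the remaining case (`card_badUnforged_le`), condition on the keys of `Y`, the MAC keys of `X`
and the ciphertext of `X`; handing the MAC keys to `Y` costs nothing here. The one-time pad leaves
the pair (hidden set `Ω`, hash keys of `X`) uniform over all pairs compatible with the keys of `Y`.
The view fixes the set `D` of indices at which `Y` deviates from the hashes of `m` and, after a
success, the false claim `m'`. Success forces `Ω` to avoid `D`. The honest player matches `m`
everywhere, so an unfavorable verdict forces `N - |D| ≤ n + c`, where `c` counts collisions of `m'`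
with `m` outside `Ω`; that is, `c ≥ n - |D|`.

Avoiding `D` has probability at most `2 ^ (-|D|)`. For a fixed `Ω` the keys outside it are
independent, so by Markov's inequality for `2 ^ c` the collisions have probability at most `2 ^ (|D|
- n) * (1 + δ) ^ n`. The powers `2 ^ |D|` cancel, whatever `D` is, leaving `((1 + δ) / 2) ^ n`
(`card_avoid_and_collide_le`). Here `δ ≤ 1/2`, and `n` is chosen so that `(3/4) ^ n ≤ ε / 16`.

The primitives exist by evaluating polynomials over finite fields of characteristic two. -/

/-! ### Counting forms of resampling and conditioning -/

open Classical in
/-- If resampling one component `get a` of a uniform `a` makes `p` hold with probability at most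
`δ`, then `p` holds with probability at most `δ`. -/
theorem card_filter_le_of_resample {α γ : Type*} [Fintype α] [Fintype γ] [Nonempty γ]
    (get : α → γ) (set : α → γ → α) (get_set : ∀ a c, get (set a c) = c)
    (set_set : ∀ a c c', set (set a c) c' = set a c') (set_get : ∀ a, set a (get a) = a)
    (p : α → Prop) (δ : ℝ)
    (h : ∀ a, ((Finset.univ.filter fun c => p (set a c)).card : ℝ) ≤ δ * Fintype.card γ) :
    ((Finset.univ.filter p).card : ℝ) ≤ δ * Fintype.card α := by
  -- Exchanging the component of `a` with an independent sample is an involution, hence preserves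
  -- the uniform distribution on `α × γ`.
  let e : α × γ ≃ α × γ :=
    { toFun := fun x => (set x.1 x.2, get x.1)
      invFun := fun x => (set x.1 x.2, get x.1)
      left_inv := fun x => by simp [get_set, set_set, set_get]
      right_inv := fun x => by simp [get_set, set_set, set_get] }
  have key : (Fintype.card γ : ℝ) * (Finset.univ.filter p).card
      = ∑ a, ((Finset.univ.filter fun c => p (set a c)).card : ℝ) := by
    have h1 : ∑ x : α × γ, (if p x.1 then (1 : ℝ) else 0)
        = ∑ x : α × γ, (if p (set x.1 x.2) then (1 : ℝ) else 0) :=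
      (Equiv.sum_comp e fun x => if p x.1 then (1 : ℝ) else 0).symm
    rw [Fintype.sum_prod_type_right, Fintype.sum_prod_type] at h1
    simp only [Finset.sum_const, Finset.card_univ, nsmul_eq_mul, Finset.sum_boole] at h1
    exact h1
  have hγ : (0 : ℝ) < Fintype.card γ := by exact_mod_cast Fintype.card_pos
  have hsum := Finset.sum_le_sum fun a (_ : a ∈ (Finset.univ : Finset α)) => h a
  rw [← key, Finset.sum_const, nsmul_eq_mul, Finset.card_univ] at hsum
  refine le_of_mul_le_mul_left ?_ hγ
  linarith

open Classical in
/-- A conditional probability bound for every value of `V` gives an unconditional one. -/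
theorem card_filter_le_of_fiberwise {α β : Type*} [Fintype α] [Fintype β] (V : α → β)
    (p : α → Prop) (δ : ℝ)
    (h : ∀ v, ((Finset.univ.filter fun a => V a = v ∧ p a).card : ℝ)
      ≤ δ * (Finset.univ.filter fun a => V a = v).card) :
    ((Finset.univ.filter p).card : ℝ) ≤ δ * Fintype.card α := by
  have h1 := Finset.card_eq_sum_card_fiberwise (f := V) (s := Finset.univ.filter p)
    (t := Finset.univ) (by simp)
  have h2 := Finset.card_eq_sum_card_fiberwise (f := V) (s := (Finset.univ : Finset α))
    (t := Finset.univ) (by simp)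
  rw [← Finset.card_univ, h1, h2]
  push_cast
  rw [Finset.mul_sum]
  refine Finset.sum_le_sum fun v _ => ?_
  rw [Finset.filter_filter]
  simpa only [and_comm] using h v

/-! ### Hidden subsets and collisions -/

/-- Removing one of `m + 1` elements multiplies the number of `n`-subsets by `(m + 1 - n) / (m +
1)`, which is at most `1/2` as long as `m + 1 ≤ 2 * n`. -/
theorem two_pow_mul_choose_le {n d : ℕ} (hd : d ≤ 2 * n) :
    2 ^ d * (2 * n - d).choose n ≤ (2 * n).choose n := by
  induction d with
  | zero => simp
  | succ d ih =>
    refine le_trans ?_ (ih (by omega))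
    obtain ⟨m, hm⟩ : ∃ m, 2 * n - d = m + 1 := ⟨2 * n - d - 1, by omega⟩
    have hm' : 2 * n - (d + 1) = m := by omega
    rw [hm, hm', pow_succ, mul_assoc]
    refine Nat.mul_le_mul_left _ ?_
    rcases Nat.lt_or_ge m n with hlt | hge
    · simp [Nat.choose_eq_zero_of_lt hlt]
    · have h := Nat.choose_mul_succ_eq m n
      have h3 : m + 1 ≤ 2 * n := by omega
      have h4 : 2 * (m + 1 - n) ≤ m + 1 := by omega
      refine Nat.le_of_mul_le_mul_right (c := m + 1) ?_ (Nat.succ_pos m)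
      rw [mul_assoc, h]
      calc 2 * ((m + 1).choose n * (m + 1 - n)) = (m + 1).choose n * (2 * (m + 1 - n)) := by ring
        _ ≤ _ := Nat.mul_le_mul_left _ h4

open Classical in
/-- A uniform `n`-subset of `2 * n` indices avoids `D` with probability at most `2 ^ (-|D|)`. -/
theorem card_disjoint_le {N n : ℕ} (hN : N = 2 * n) (D : Finset (Fin N)) :
    2 ^ D.card * (((Finset.univ : Finset (Fin N)).powersetCard n).filter
      fun Ω => Disjoint Ω D).card ≤ N.choose n := by
  have : (((Finset.univ : Finset (Fin N)).powersetCard n).filter fun Ω => Disjoint Ω D)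
      = Dᶜ.powersetCard n := by
    ext Ω
    simp only [Finset.mem_filter, Finset.mem_powersetCard, Finset.subset_univ, true_and,
      Finset.subset_compl_iff_disjoint_right]
    tauto
  rw [this, Finset.card_powersetCard, Finset.card_compl, Fintype.card_fin]
  subst hN
  exact two_pow_mul_choose_le (by simpa using Finset.card_le_univ D)

open Classical in
/-- The key vectors that agree with `k₀` on `Ω`. -/
noncomputable def agreeing {N : ℕ} {α : Type*} [Fintype α] (k₀ : Fin N → α) (Ω : Finset (Fin N)) :
    Finset (Fin N → α) :=
  Fintype.piFinset fun j => if j ∈ Ω then {k₀ j} else Finset.univ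

theorem mem_agreeing {N : ℕ} {α : Type*} [Fintype α] {k₀ k : Fin N → α} {Ω : Finset (Fin N)} :
    k ∈ agreeing k₀ Ω ↔ ∀ j ∈ Ω, k j = k₀ j := by
  classical
  rw [agreeing, Fintype.mem_piFinset]
  refine forall_congr' fun j => ?_
  by_cases hj : j ∈ Ω <;> simp [hj]

-- The keys outside `Ω` are free, so the sum factorizes over `Ωᶜ`. Taking `g = 1` counts keys;
-- taking `g = 2` on collisions and `1` elsewhere gives an exponential moment.
open Classical in
theorem sum_agreeing_prod {N : ℕ} {α : Type*} [Fintype α] (k₀ : Fin N → α) (Ω : Finset (Fin N))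
    (g : α → ℝ) :
    ∑ k ∈ agreeing k₀ Ω, ∏ j ∈ Ωᶜ, g (k j) = (∑ a, g a) ^ (N - Ω.card) := by
  -- Padding with factors `1` on `Ω` gives a product over all indices, to which
  -- `Finset.prod_univ_sum` applies.
  have h1 : ∀ k : Fin N → α, ∏ j ∈ Ωᶜ, g (k j) = ∏ j, if j ∈ Ω then 1 else g (k j) := by
    intro k
    rw [Finset.prod_ite]
    simp only [Finset.prod_const_one, one_mul]
    refine Finset.prod_congr ?_ fun _ _ => rfl
    ext; simp
  simp only [h1, agreeing]
  rw [← Finset.prod_univ_sum (f := fun j a => if j ∈ Ω then 1 else g a)]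
  have h2 : ∀ j, (∑ a ∈ (if j ∈ Ω then {k₀ j} else Finset.univ), if j ∈ Ω then 1 else g a)
      = if j ∈ Ω then 1 else ∑ a, g a := by
    intro j
    by_cases hj : j ∈ Ω <;> simp [hj]
  simp only [h2]
  rw [Finset.prod_ite]
  simp only [Finset.prod_const_one, one_mul, Finset.prod_const]
  have h3 : (Finset.univ.filter fun j => j ∉ Ω) = Ωᶜ := by ext; simp
  rw [h3, Finset.card_compl, Fintype.card_fin]

open Classical in
theorem card_agreeing {N : ℕ} {α : Type*} [Fintype α] (k₀ : Fin N → α) (Ω : Finset (Fin N)) :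
    ((agreeing k₀ Ω).card : ℝ) = (Fintype.card α : ℝ) ^ (N - Ω.card) := by
  simpa using sum_agreeing_prod k₀ Ω fun _ => 1

open Classical in
/-- The combined bound: the hidden set has to avoid `D`, and the keys outside the hidden set have to
produce at least `n - |D|` collisions. -/
theorem card_avoid_and_collide_le {N n : ℕ} (hN : N = 2 * n) {α : Type*} [Fintype α]
    [Nonempty α] (k₀ : Fin N → α) (D : Finset (Fin N)) (coll : α → Prop) (δ : ℝ)
    (hδ : ((Finset.univ.filter coll).card : ℝ) ≤ δ * Fintype.card α) :
    ((Finset.univ.filter fun y : Finset (Fin N) × (Fin N → α) =>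
      (y.1.card = n ∧ ∀ j ∈ y.1, y.2 j = k₀ j) ∧ Disjoint y.1 D ∧
        n ≤ D.card + (y.1ᶜ.filter fun j => coll (y.2 j)).card).card : ℝ)
    ≤ ((1 + δ) / 2) ^ n * (Finset.univ.filter fun y : Finset (Fin N) × (Fin N → α) =>
      y.1.card = n ∧ ∀ j ∈ y.1, y.2 j = k₀ j).card := by
  set U := (Finset.univ : Finset (Fin N)).powersetCard n
  set q : ℝ := (Fintype.card α : ℝ)
  have hNn : N - n = n := by omega
  have hU : ∀ {Ω}, Ω ∈ U ↔ Ω.card = n := by simp [U]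
  have e1 : (Finset.univ.filter fun y : Finset (Fin N) × (Fin N → α) =>
      y.1.card = n ∧ ∀ j ∈ y.1, y.2 j = k₀ j).card = ∑ Ω ∈ U, (agreeing k₀ Ω).card := by
    rw [← Finset.card_sigma]
    refine Finset.card_nbij' (fun y => ⟨y.1, y.2⟩) (fun y => (y.1, y.2)) ?_ ?_ ?_ ?_
    · intro y; simp [hU, mem_agreeing]
    · intro y; simp [hU, mem_agreeing]
    · intro y _; rfl
    · intro y _; rfl
  have e2 : (Finset.univ.filter fun y : Finset (Fin N) × (Fin N → α) =>
      (y.1.card = n ∧ ∀ j ∈ y.1, y.2 j = k₀ j) ∧ Disjoint y.1 D ∧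
        n ≤ D.card + (y.1ᶜ.filter fun j => coll (y.2 j)).card).card
      = ∑ Ω ∈ U.filter (fun Ω => Disjoint Ω D), ((agreeing k₀ Ω).filter fun k =>
          n ≤ D.card + (Ωᶜ.filter fun j => coll (k j)).card).card := by
    rw [← Finset.card_sigma]
    refine Finset.card_nbij' (fun y => ⟨y.1, y.2⟩) (fun y => (y.1, y.2)) ?_ ?_ ?_ ?_
    · intro y; simp [hU, mem_agreeing]; tauto
    · intro y; simp [hU, mem_agreeing]; tauto
    · intro y _; rfl
    · intro y _; rfl
  have e3 : ((∑ Ω ∈ U, (agreeing k₀ Ω).card : ℕ) : ℝ) = (N.choose n : ℝ) * q ^ n := by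
    push_cast
    rw [Finset.sum_congr rfl fun Ω hΩ => by rw [card_agreeing, hU.1 hΩ, hNn]]
    simp [U, q]
  -- Markov's inequality for 2 to the number of collisions: on the event, the weight `2 ^ (|D| +
  -- collisions - n)` is at least 1.
  have e4 : ∀ Ω ∈ U, (((agreeing k₀ Ω).filter fun k =>
      n ≤ D.card + (Ωᶜ.filter fun j => coll (k j)).card).card : ℝ)
      ≤ 2 ^ D.card / 2 ^ n * ((1 + δ) * q) ^ n := by
    intro Ω hΩ
    have hg : ∑ a : α, (if coll a then (2 : ℝ) else 1) ≤ (1 + δ) * q := by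
      have : ∀ a : α, (if coll a then (2 : ℝ) else 1) = 1 + if coll a then 1 else 0 := by
        intro a; split_ifs <;> norm_num
      simp only [this, Finset.sum_add_distrib, Finset.sum_boole]
      simp only [Finset.sum_const, Finset.card_univ, nsmul_eq_mul, mul_one]
      linarith
    have hg0 : 0 ≤ ∑ a : α, (if coll a then (2 : ℝ) else 1) :=
      Finset.sum_nonneg fun a _ => by split_ifs <;> norm_num
    have hs := sum_agreeing_prod k₀ Ω fun a => if coll a then (2 : ℝ) else 1
    rw [hU.1 hΩ, hNn] at hs
    calc _ = ∑ k ∈ (agreeing k₀ Ω).filter fun k =>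
          n ≤ D.card + (Ωᶜ.filter fun j => coll (k j)).card, (1 : ℝ) := by simp
      _ ≤ ∑ k ∈ (agreeing k₀ Ω).filter fun k =>
          n ≤ D.card + (Ωᶜ.filter fun j => coll (k j)).card,
          2 ^ D.card / 2 ^ n * ∏ j ∈ Ωᶜ, (if coll (k j) then (2 : ℝ) else 1) := by
        refine Finset.sum_le_sum fun k hk => ?_
        have hk2 := (Finset.mem_filter.1 hk).2
        rw [Finset.prod_ite]
        simp only [Finset.prod_const, one_pow, mul_one]
        rw [div_mul_eq_mul_div, ← pow_add, one_le_div (by positivity)]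
        exact pow_le_pow_right₀ (by norm_num) hk2
      _ ≤ ∑ k ∈ agreeing k₀ Ω,
          2 ^ D.card / 2 ^ n * ∏ j ∈ Ωᶜ, (if coll (k j) then (2 : ℝ) else 1) :=
        Finset.sum_le_sum_of_subset_of_nonneg (Finset.filter_subset _ _) fun k _ _ =>
          mul_nonneg (by positivity)
            (Finset.prod_nonneg fun j _ => by split_ifs <;> norm_num)
      _ ≤ _ := by
        rw [← Finset.mul_sum, hs]
        gcongr
  rw [e1, e2, e3]
  push_cast
  have hq : 0 < q := by simp only [q]; exact_mod_cast Fintype.card_pos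
  have hδ0 : 0 ≤ 1 + δ := by
    have : 0 ≤ δ * q := le_trans (by positivity) hδ
    have := nonneg_of_mul_nonneg_left this hq
    linarith
  -- This absorbs the factor `2 ^ |D|` of `e4`; base 2 in the exponential moment was chosen for
  -- this.
  have hc : (2 : ℝ) ^ D.card * (U.filter fun Ω => Disjoint Ω D).card ≤ N.choose n := by
    exact_mod_cast card_disjoint_le hN D
  calc _ ≤ ∑ Ω ∈ U.filter (fun Ω => Disjoint Ω D), 2 ^ D.card / 2 ^ n * ((1 + δ) * q) ^ n :=
        Finset.sum_le_sum fun Ω hΩ => e4 Ω (Finset.mem_filter.1 hΩ).1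
    _ = (2 ^ D.card * (U.filter fun Ω => Disjoint Ω D).card) * (((1 + δ) / 2) ^ n * q ^ n) := by
        rw [Finset.sum_const, nsmul_eq_mul, mul_pow, div_pow]; ring
    _ ≤ N.choose n * (((1 + δ) / 2) ^ n * q ^ n) := by gcongr
    _ = _ := by ring

/-! ### Hashing and authentication by polynomial evaluation -/

section PolynomialPrimitives

open Polynomial

theorem card_bits (t : ℕ) : Fintype.card (Bits t) = 2 ^ t := by simp [Bits]

/-- Messages of `L` bits, encoded injectively as polynomials of degree less than `q`. -/
theorem exists_polynomial_encoding {F : Type*} [Field F] [Fintype F] {t L q : ℕ}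
    (hF : Fintype.card F = 2 ^ t) (hL : L ≤ t * q) :
    ∃ φ : Bits L → F[X], Function.Injective φ ∧ ∀ m, (φ m).degree < q := by
  have hc : Fintype.card (Bits L) ≤ Fintype.card (Fin q → F) := by
    rw [card_bits, Fintype.card_fun, hF, Fintype.card_fin, ← pow_mul]
    exact Nat.pow_le_pow_right (by norm_num) hL
  obtain ⟨ι⟩ := Function.Embedding.nonempty_of_card_le hc
  refine ⟨fun m => ((degreeLTEquiv F q).symm (ι m) : F[X]), ?_, ?_⟩
  · intro m m' h
    exact ι.injective ((degreeLTEquiv F q).symm.injective (Subtype.ext h))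
  · intro m
    exact mem_degreeLT.1 ((degreeLTEquiv F q).symm (ι m)).2

theorem card_filter_eval_eq_zero_le {F : Type*} [Field F] [Fintype F] [DecidableEq F]
    {p : F[X]} (hp : p ≠ 0) :
    (Finset.univ.filter fun x : F => p.eval x = 0).card ≤ p.natDegree := by
  have : (Finset.univ.filter fun x : F => p.eval x = 0) = p.roots.toFinset := by
    ext x; simp [hp]
  rw [this]
  exact (Multiset.toFinset_card_le _).trans (card_roots' p)

theorem exists_field_equiv_bits {t : ℕ} (ht : t ≠ 0) :
    ∃ (F : Type) (_ : Field F) (_ : Fintype F), Fintype.card F = 2 ^ t ∧ Nonempty (Bits t ≃ F) := by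
  let _ := Fintype.ofFinite (GaloisField 2 t)
  have hc : Fintype.card (GaloisField 2 t) = 2 ^ t := by
    rw [← Nat.card_eq_fintype_card, GaloisField.card 2 t ht]
  exact ⟨GaloisField 2 t, inferInstance, inferInstance, hc,
    ⟨Fintype.equivOfCardEq (by rw [card_bits, hc])⟩⟩

/-- Polynomial hashing. -/
theorem exists_hash {l r q : ℕ} (hl : l ≠ 0) (hq : r ≤ l * (q + 1)) :
    ∃ f : Bits l → Bits r → Bits l, IsAlmostUniversal f ((q : ℝ) * (2 : ℝ)⁻¹ ^ l) := by
  classical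
  obtain ⟨F, _, _, hF, ⟨e⟩⟩ := exists_field_equiv_bits hl
  obtain ⟨φ, hφ, hdeg⟩ := exists_polynomial_encoding hF hq
  refine ⟨fun k m => e.symm ((φ m).eval (e k)), fun m m' hne => ?_⟩
  have hp : φ m - φ m' ≠ 0 := sub_ne_zero.2 fun h => hne (hφ h)
  -- Messages have `q + 1` coefficients, so the degree is at most `q`; colliding keys are roots of
  -- the difference.
  have hd : (φ m - φ m').natDegree ≤ q := by
    have := (degree_sub_le (φ m) (φ m')).trans_lt (max_lt (hdeg m) (hdeg m'))
    have := (natDegree_lt_iff_degree_lt hp).2 this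
    omega
  have hc : (Finset.univ.filter fun k : Bits l =>
      e.symm ((φ m).eval (e k)) = e.symm ((φ m').eval (e k))).card ≤ q := by
    refine le_trans ?_ ((card_filter_eval_eq_zero_le hp).trans hd)
    refine Finset.card_le_card_of_injOn e ?_ e.injective.injOn
    intro k hk
    simpa [sub_eq_zero] using hk
  rw [inv_pow, ← div_eq_mul_inv]
  gcongr

/-- The polynomial one-time MAC. -/
theorem exists_mac {t L q : ℕ} (ht : t ≠ 0) (hq : L ≤ t * q) :
    ∃ g : Bits (2 * t) → Bits L → Bits t, IsSecureMAC g ((q : ℝ) * (2 : ℝ)⁻¹ ^ t) := by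
  classical
  obtain ⟨F, _, _, hF, ⟨e⟩⟩ := exists_field_equiv_bits ht
  obtain ⟨φ, hφ, hdeg⟩ := exists_polynomial_encoding hF hq
  have hcard : Fintype.card (Bits (2 * t)) = Fintype.card (F × F) := by
    rw [card_bits, Fintype.card_prod, hF, ← pow_add, two_mul]
  let E : Bits (2 * t) ≃ F × F := Fintype.equivOfCardEq hcard
  -- The factor `X` removes the constant term, so no guessed difference of tags can cancel `X * (φ
  -- m' - φ m)`.
  let tag : Bits (2 * t) → Bits L → F := fun k m => (E k).2 + (X * φ m).eval (E k).1
  refine ⟨fun k m => e.symm (tag k m), fun m A => ?_⟩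
  set B := Finset.univ.filter fun k : Bits (2 * t) => (A (e.symm (tag k m))).1 ≠ m ∧
    e.symm (tag k (A (e.symm (tag k m))).1) = (A (e.symm (tag k m))).2 with hB
  -- Once the tag `y` is fixed, so is the forger's output, and the first half of the key determines
  -- the second. A successful forgery makes that first half a root of `p`, of degree at most `q`.
  have hfib : ∀ y ∈ (Finset.univ : Finset F), (B.filter fun k => tag k m = y).card ≤ q := by
    intro y _
    set m' := (A (e.symm y)).1 with hm'
    set y' := e (A (e.symm y)).2 with hy'
    by_cases hne : m' = m
    · have : (B.filter fun k => tag k m = y) = ∅ := by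
        refine Finset.filter_eq_empty_iff.2 fun k hk hky => ?_
        rw [hB, Finset.mem_filter, hky] at hk
        exact hk.2.1 hne
      simp [this]
    have hp0 : φ m' - φ m ≠ 0 := sub_ne_zero.2 fun h => hne (hφ h)
    set p := X * (φ m' - φ m) - C (y' - y) with hp
    have hpne : p ≠ 0 := by
      intro h
      have h1 : X * (φ m' - φ m) = C (y' - y) := sub_eq_zero.1 h
      have h2 := congrArg natDegree h1
      rw [natDegree_X_mul hp0, natDegree_C] at h2
      omega
    have hd0 : (φ m' - φ m).natDegree < q :=
      (natDegree_lt_iff_degree_lt hp0).2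
        ((degree_sub_le _ _).trans_lt (max_lt (hdeg m') (hdeg m)))
    have hd : p.natDegree ≤ q := by
      rw [hp, natDegree_sub_C, natDegree_X_mul hp0]
      omega
    refine le_trans ?_ ((card_filter_eval_eq_zero_le hpne).trans hd)
    refine Finset.card_le_card_of_injOn (fun k => (E k).1) ?_ ?_
    · intro k hk
      simp only [hB, Finset.coe_filter, Finset.mem_filter, Finset.mem_univ, true_and,
        Set.mem_ofPred_eq] at hk ⊢
      obtain ⟨⟨-, h1⟩, h2⟩ := hk
      rw [h2, ← hm', Equiv.symm_apply_eq, ← hy'] at h1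
      rw [hp, ← h1, ← h2]
      simp only [tag, eval_sub, eval_mul, eval_X, eval_C]
      ring
    · intro k hk k' hk' h
      have h1 : tag k m = y := (Finset.mem_filter.1 hk).2
      have h2 : tag k' m = y := (Finset.mem_filter.1 hk').2
      have h : (E k).1 = (E k').1 := h
      refine E.injective (Prod.ext h ?_)
      rw [← h2] at h1
      simp only [tag, h] at h1
      exact add_right_cancel h1
  have hc : B.card ≤ q * 2 ^ t := by
    have := Finset.card_le_mul_card_image_of_maps_to (s := B) (t := (Finset.univ : Finset F))
      (f := fun k => tag k m) (fun _ _ => Finset.mem_univ _) q hfib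
    rwa [Finset.card_univ, hF] at this
  rw [div_le_iff₀ (by positivity)]
  calc (B.card : ℝ) ≤ q * 2 ^ t := by exact_mod_cast hc
    _ = _ := by rw [two_mul, pow_add, inv_pow]; field_simp

end PolynomialPrimitives

/-- Polynomials over the fields with `2 ^ l` and `2 ^ (n + l)` elements attain the required bounds.
The condition `l ≤ r` makes `r / l - 1` nonnegative, so its integer and natural ceilings coincide.
-/
theorem exists_admissible (P : Params) (hl : P.l ≠ 0) (hr : P.l ≤ P.r) :
    ∃ S : Primitives P, S.Admissible := by
  have hl' : (0 : ℝ) < P.l := by positivity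
  have key : ∀ (L t : ℕ), t ≠ 0 → L ≤ t * ⌈(L : ℝ) / t⌉₊ := by
    intro L t ht
    have h := Nat.le_ceil ((L : ℝ) / t)
    rw [div_le_iff₀ (by positivity)] at h
    have h' : (L : ℝ) ≤ ((⌈(L : ℝ) / t⌉₊ * t : ℕ) : ℝ) := by exact_mod_cast h
    rw [mul_comm]
    exact_mod_cast h'
  obtain ⟨f, hf⟩ := exists_hash (l := P.l) (r := P.r) (q := ⌈(P.r : ℝ) / P.l - 1⌉₊) hl (by
    have h := Nat.le_ceil ((P.r : ℝ) / P.l - 1)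
    rw [sub_le_iff_le_add, div_le_iff₀ hl'] at h
    rw [mul_comm]
    exact_mod_cast h)
  have hex : ∀ L : ℕ, ∃ g : Bits (2 * (P.n + P.l)) → Bits L → Bits (P.n + P.l),
      IsSecureMAC g ((⌈(L : ℝ) / ((P.n + P.l : ℕ) : ℝ)⌉₊ : ℝ) * (2 : ℝ)⁻¹ ^ (P.n + P.l)) :=
    fun L => exists_mac (by omega) (key L _ (by omega))
  choose g hg using hex
  refine ⟨⟨f, g⟩, ?_, fun L => ?_⟩
  · rw [← natCast_ceil_eq_intCast_ceil]
    · exact hf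
    · rw [sub_nonneg, one_le_div hl']
      exact_mod_cast hr
  · rw [← natCast_ceil_eq_intCast_ceil (by positivity)]
    simpa using hg L

/-! ### Players, encodings and modification of key material -/

theorem Player.other_ne (X : Player) : X.other ≠ X := by cases X <;> decide

theorem Player.eq_or_eq_other (X Y : Player) : Y = X ∨ Y = X.other := by
  cases X <;> cases Y <;> decide

theorem Bits.xor_xor_cancel {k : ℕ} (x y : Bits k) : Bits.xor (Bits.xor x y) y = x := by
  funext i; simp [Bits.xor]

theorem unflatten_flatten {N l : ℕ} (s : Fin N → Bits l) : unflatten (flatten s) = s := by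
  funext j i; simp [unflatten, flatten]

namespace KeyMaterial

variable {P : Params}

theorem agree (K : KeyMaterial P) (X : Player) :
    ∀ j ∈ K.hidden, (K.key X).et j = (K.key X.other).et j := by
  intro j hj
  cases X
  · exact K.2.2 j hj
  · exact (K.2.2 j hj).symm

/-- Key material from its hidden set and the keys of `X` and the other player. -/
def mk' (X : Player) (Ω : Finset (Fin P.N)) (kX kY : PlayerKey P)
    (h : Ω.card = P.n ∧ ∀ j ∈ Ω, kX.et j = kY.et j) : KeyMaterial P :=
  ⟨(Ω, fun Y => if Y = X then kX else kY), h.1, fun j hj => by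
    have := h.2 j hj
    cases X
    · simpa using this
    · simpa using this.symm⟩

@[simp] theorem hidden_mk' (X : Player) (Ω : Finset (Fin P.N)) (kX kY : PlayerKey P) (h) :
    (mk' X Ω kX kY h).hidden = Ω := rfl

@[simp] theorem key_mk' (X : Player) (Ω : Finset (Fin P.N)) (kX kY : PlayerKey P) (h) :
    (mk' X Ω kX kY h).key X = kX := by simp [mk', key]

@[simp] theorem key_other_mk' (X : Player) (Ω : Finset (Fin P.N)) (kX kY : PlayerKey P) (h) :
    (mk' X Ω kX kY h).key X.other = kY := by simp [mk', key, Player.other_ne]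

theorem ext_keys {K K' : KeyMaterial P} (X : Player) (h : K.hidden = K'.hidden)
    (h1 : K.key X = K'.key X) (h2 : K.key X.other = K'.key X.other) : K = K' := by
  refine Subtype.ext (Prod.ext h (funext fun Y => ?_))
  rcases X.eq_or_eq_other Y with rfl | rfl
  · exact h1
  · exact h2

/-- Replace one MAC key of player `X`. -/
def setMac (K : KeyMaterial P) (X : Player) (R : Round) (κ : Bits (2 * (P.n + P.l))) :
    KeyMaterial P :=
  mk' X K.hidden
    ⟨(K.key X).et, ⟨(K.key X).sc.pad, Function.update (K.key X).sc.mac R κ⟩⟩ (K.key X.other)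
    ⟨K.2.1, K.agree X⟩

variable (K : KeyMaterial P) (X : Player) (R : Round) (κ κ' : Bits (2 * (P.n + P.l)))

@[simp] theorem hidden_setMac : (K.setMac X R κ).hidden = K.hidden := rfl

@[simp] theorem key_setMac : (K.setMac X R κ).key X =
    ⟨(K.key X).et, ⟨(K.key X).sc.pad, Function.update (K.key X).sc.mac R κ⟩⟩ := by
  simp [setMac]

@[simp] theorem key_other_setMac : (K.setMac X R κ).key X.other = K.key X.other := by
  simp [setMac]

theorem setMac_setMac : (K.setMac X R κ).setMac X R κ' = K.setMac X R κ' :=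
  ext_keys X rfl (by simp) (by simp)

theorem setMac_mac : K.setMac X R ((K.key X).sc.mac R) = K :=
  ext_keys X rfl (by simp) (by simp)

/-- Given all other keys, a single MAC key is uniform. The forgery event `b` may therefore depend on
everything else in `K`. -/
theorem card_filter_le_of_mac (p : KeyMaterial P → Prop) [DecidablePred p] (δ : ℝ)
    (h : ∀ K : KeyMaterial P, ∃ b : Bits (2 * (P.n + P.l)) → Prop, ∃ _ : DecidablePred b,
      (∀ κ, p (K.setMac X R κ) → b κ) ∧
        ((Finset.univ.filter b).card : ℝ) / 2 ^ (2 * (P.n + P.l)) ≤ δ) :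
    ((Finset.univ.filter p).card : ℝ) ≤ δ * Fintype.card (KeyMaterial P) := by
  classical
  convert card_filter_le_of_resample (fun K : KeyMaterial P => (K.key X).sc.mac R)
    (fun K κ => K.setMac X R κ) (fun K κ => by simp) (fun K κ κ' => K.setMac_setMac X R κ κ')
    (fun K => K.setMac_mac X R) p δ (fun K => ?_)
  obtain ⟨b, _, hb, hδ⟩ := h K
  rw [div_le_iff₀ (by positivity)] at hδ
  rw [card_bits]
  push_cast
  refine le_trans ?_ hδ
  exact_mod_cast Finset.card_le_card fun κ hκ => by
    simp only [Finset.mem_filter, Finset.mem_univ, true_and] at hκ ⊢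
    exact hb κ hκ

end KeyMaterial

/-! ### Honest behavior, verdicts, lengths of transcripts and keys -/

namespace Primitives

variable {P : Params} (S : Primitives P)

theorem receivedHashes_etMessage (K : KeyMaterial P) (p : Player → Packet P (P.N * P.l))
    (X : Player) (m : Bits P.r) (h : (p X).1 = (S.etMessage (K.key X) m).1) :
    receivedHashes K p X = fun j => S.hash ((K.key X).et j) m := by
  rw [receivedHashes, h, etMessage, sign, Bits.xor_xor_cancel, unflatten_flatten]

theorem sound : S.Sound := by
  intro K m
  simp only [etResult, decide_eq_true_eq]
  refine ⟨fun X => rfl, fun j hj => ?_⟩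
  rw [S.receivedHashes_etMessage K _ .A m rfl, S.receivedHashes_etMessage K _ .B m rfl]
  simp only [K.2.2 j hj, KeyMaterial.key]

theorem etResult_eq_true {K : KeyMaterial P} {p : Player → Packet P (P.N * P.l)}
    (h : S.etResult K p = true) (X : Player) :
    (∀ Y, S.Verifies ((K.key Y).sc.mac .et) (p Y)) ∧
      ∀ j ∈ K.hidden, receivedHashes K p X j = receivedHashes K p X.other j := by
  simp only [etResult, decide_eq_true_eq] at h
  refine ⟨h.1, fun j hj => ?_⟩
  cases X
  · exact h.2 j hj
  · exact (h.2 j hj).symm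

/-- Arbitration tests Alice first, so the case of Bob needs that both cannot prevail: with full
self-matches on both sides, each would need strictly more cross-matches than the other. -/
theorem not_prevails_of_unfavorable {K : KeyMaterial P} {s : Player → Fin P.N → Bits P.l}
    {m : Player → Bits P.r} {X : Player} (h : (S.arbitrate K s m).unfavorableTo X) :
    m X ≠ m X.other ∧ ¬ S.Prevails K s m X := by
  have hAB : S.Prevails K s m .B → ¬ S.Prevails K s m .A := by
    simp only [Prevails, Player.other]
    omega
  unfold arbitrate Verdict.unfavorableTo at h
  cases X <;> simp only [Player.other] at h ⊢ <;> split_ifs at h with h1 h2 h3 <;> simp_all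
  all_goals exact fun h => h1 h.symm

theorem length_bits {L : ℕ} (p : Packet P L) : p.bits.length = L + (P.n + P.l) := by
  simp [Packet.bits]

theorem etCommunication_eq (hN : P.N = 2 * P.n) (K : KeyMaterial P) (m : Player → Bits P.r) :
    S.etCommunication K m = 4 * (P.n * P.l + P.n + P.l + 1) := by
  simp only [etCommunication, etTranscript, List.length_flatten, List.map_cons, List.map_nil,
    List.sum_cons, List.sum_nil, length_bits, hN]
  ring

theorem drCommunication_eq (K : KeyMaterial P) (m m' : Player → Bits P.r) :
    S.drCommunication K m m' = 2 * (P.r + 2 * P.n + 2 * P.l + 2) := by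
  have h : ∀ X, S.Verifies ((K.key X).sc.mac .dr) (S.drMessage (K.key X) (m' X)) := fun _ => rfl
  simp only [drCommunication, drTranscript, drResult, h, implies_true, if_true,
    List.length_flatten, List.map_cons, List.map_nil, List.map_append, List.sum_append,
    List.sum_cons, List.sum_nil, length_bits]
  ring

end Primitives

theorem PlayerKey.length_scBits {P : Params} (k : PlayerKey P) :
    k.scBits.length = P.N * P.l + 8 * (P.n + P.l) := by
  simp only [scBits, List.length_append, List.length_ofFn]
  ring

theorem PlayerKey.length_etBits {P : Params} (k : PlayerKey P) :
    k.etBits.length = P.N * P.l := by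
  simp [etBits]

/-! ### Winning events and forgeries -/

namespace Primitives

variable {P : Params} (S : Primitives P)

/-- The packets which the TTP receives in the equality-testing phase. -/
def received (X : Player) (m : Bits P.r) (τ : Strategy P) (K : KeyMaterial P) :
    Player → Packet P (P.N * P.l) :=
  τ.et (K.key X.other) (S.etMessage (K.key X) m)

/-- The packets which the TTP receives in the dispute-resolution phase. -/
noncomputable def claimed (X : Player) (m : Bits P.r) (τ : Strategy P) (K : KeyMaterial P) :
    Player → Packet P P.r :=
  τ.dr (K.key X.other) (S.etMessage (K.key X) m)
    (S.etAnnouncement K (S.etResult K (S.received X m τ K))) (S.drMessage (K.key X) m)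

/-- The malicious player wins: success, and then a verdict unfavorable to `X`. -/
def Bad (X : Player) (m : Bits P.r) (τ : Strategy P) (K : KeyMaterial P) : Prop :=
  (S.run X m K τ).1 = true ∧ ∃ v, (S.run X m K τ).2 = some v ∧ v.unfavorableTo X

/-- The packet received in the name of `X` in the equality-testing phase is a forgery. -/
def EtForged (X : Player) (m : Bits P.r) (τ : Strategy P) (K : KeyMaterial P) : Prop :=
  (S.received X m τ K X).1 ≠ (S.etMessage (K.key X) m).1 ∧
    S.Verifies ((K.key X).sc.mac .et) (S.received X m τ K X)

/-- The packet received in the name of `X` in the dispute-resolution phase is a forgery. -/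
def DrForged (X : Player) (m : Bits P.r) (τ : Strategy P) (K : KeyMaterial P) : Prop :=
  (S.claimed X m τ K X).1 ≠ m ∧ S.Verifies ((K.key X).sc.mac .dr) (S.claimed X m τ K X)

/-- The malicious player wins although the packets received in the name of `X` are authentic. -/
def BadUnforged (X : Player) (m : Bits P.r) (τ : Strategy P) (K : KeyMaterial P) : Prop :=
  S.Bad X m τ K ∧ (S.received X m τ K X).1 = (S.etMessage (K.key X) m).1 ∧
    (S.claimed X m τ K X).1 = m

theorem bad_iff {X : Player} {m : Bits P.r} {τ : Strategy P} {K : KeyMaterial P} :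
    S.Bad X m τ K ↔ S.etResult K (S.received X m τ K) = true ∧
      (∀ Y, S.Verifies ((K.key Y).sc.mac .dr) (S.claimed X m τ K Y)) ∧
      (S.arbitrate K (receivedHashes K (S.received X m τ K))
        fun Y => (S.claimed X m τ K Y).1).unfavorableTo X := by
  change (S.etResult K (S.received X m τ K) = true ∧ ∃ v,
    (if S.etResult K (S.received X m τ K) = true then
      S.drResult K (S.received X m τ K) (S.claimed X m τ K) else none) = some v ∧
        v.unfavorableTo X) ↔ _
  refine and_congr_right fun h => ?_
  rw [if_pos h, drResult]
  split_ifs with h1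
  · simp [h1]
  · simp [h1]

/-- A success followed by a verdict requires valid tags in both phases, so any altered message in
the name of `X` is a forgery. -/
theorem forged_or_of_bad {X : Player} {m : Bits P.r} {τ : Strategy P} {K : KeyMaterial P}
    (h : S.Bad X m τ K) : S.EtForged X m τ K ∨ S.DrForged X m τ K ∨ S.BadUnforged X m τ K := by
  have h' := S.bad_iff.1 h
  have h1 := (S.etResult_eq_true h'.1 X).1 X
  have h2 := h'.2.1 X
  unfold EtForged DrForged BadUnforged
  tauto

-- The ciphertext `x` does not involve the MAC key of `X` for this round, so the strategy, with all
-- other keys fixed, is a forger who sees the tag of `x`.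
open Classical in
theorem card_etForged_le {δ : ℝ} (hδ : IsSecureMAC (S.mac (P.N * P.l)) δ) (X : Player)
    (m : Bits P.r) (τ : Strategy P) :
    ((Finset.univ.filter (S.EtForged X m τ)).card : ℝ) ≤ δ * Fintype.card (KeyMaterial P) := by
  refine KeyMaterial.card_filter_le_of_mac X .et _ δ fun K => ?_
  set x := (S.etMessage (K.key X) m).1
  refine ⟨_, _, fun κ h => ?_, hδ x fun t => τ.et (K.key X.other) (x, t) X⟩
  simpa [EtForged, received, etMessage, sign, Verifies, x] using h

-- Nothing sent before the dispute, including the announcements, depends on the MAC key used in it.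
-- Hence only the tag of `m` carries information about that key.
open Classical in
theorem card_drForged_le {δ : ℝ} (hδ : IsSecureMAC (S.mac P.r) δ) (X : Player)
    (m : Bits P.r) (τ : Strategy P) :
    ((Finset.univ.filter (S.DrForged X m τ)).card : ℝ) ≤ δ * Fintype.card (KeyMaterial P) := by
  refine KeyMaterial.card_filter_le_of_mac X .dr _ δ fun K => ?_
  refine ⟨_, _, fun κ h => ?_, hδ m fun t => τ.dr (K.key X.other) (S.etMessage (K.key X) m)
    (S.etAnnouncement K (S.etResult K (S.received X m τ K))) (m, t) X⟩
  have h1 : S.etMessage ((K.setMac X .dr κ).key X) m = S.etMessage (K.key X) m := by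
    simp [etMessage]
  have h2 : S.received X m τ (K.setMac X .dr κ) = S.received X m τ K := by
    rw [received, received, KeyMaterial.key_other_setMac, h1]
  have hpad : ∀ Y, ((K.setMac X .dr κ).key Y).sc.pad = (K.key Y).sc.pad := by
    intro Y; rcases X.eq_or_eq_other Y with rfl | rfl <;> simp
  have hmac : ∀ Y R, R ≠ .dr → ((K.setMac X .dr κ).key Y).sc.mac R = (K.key Y).sc.mac R := by
    intro Y R hR; rcases X.eq_or_eq_other Y with rfl | rfl <;> simp [hR]
  have h3 : ∀ p, S.etResult (K.setMac X .dr κ) p = S.etResult K p := by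
    intro p
    have h4 : receivedHashes (K.setMac X .dr κ) p = receivedHashes K p := by
      funext Y; simp only [receivedHashes, hpad]
    simp [etResult, h4, hmac]
  have h5 : ∀ b, S.etAnnouncement (K.setMac X .dr κ) b = S.etAnnouncement K b := by
    intro b; funext Y; simp [etAnnouncement, hmac]
  simp only [DrForged, claimed, h1, h2, h3, h5, KeyMaterial.key_other_setMac] at h
  simpa [drMessage, sign, Verifies] using h

/-! ### The view of the malicious player -/

/-- The keys of the other player, the MAC keys of `X`, and the encrypted hash values of `X`. They
determine what the malicious player sees. -/
abbrev View (P : Params) : Type :=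
  PlayerKey P × (Round → Bits (2 * (P.n + P.l))) × Bits (P.N * P.l)

/-- The view that belongs to the given keys. -/
def view (X : Player) (m : Bits P.r) (K : KeyMaterial P) : View P :=
  (K.key X.other, (K.key X).sc.mac, (S.etMessage (K.key X) m).1)

/-- The hash values of the malicious player. -/
def viewHashes (X : Player) (τ : Strategy P) (v : View P) : Fin P.N → Bits P.l :=
  unflatten (Bits.xor (τ.et v.1 (S.sign (v.2.1 .et) v.2.2) X.other).1 v.1.sc.pad)

/-- The data claimed by the malicious player after a success. -/
def viewClaim (X : Player) (m : Bits P.r) (τ : Strategy P) (v : View P) : Bits P.r :=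
  (τ.dr v.1 (S.sign (v.2.1 .et) v.2.2)
    (fun Y => S.sign ((if Y = X then v.2.1 else v.1.sc.mac) .etAnn) (encodeResult true))
    (S.sign (v.2.1 .dr) m) X.other).1

open Classical in
/-- The indices at which the malicious player deviates from the hash values of `m`. -/
noncomputable def deviations (X : Player) (m : Bits P.r) (τ : Strategy P) (v : View P) :
    Finset (Fin P.N) :=
  Finset.univ.filter fun j => S.hash (v.1.et j) m ≠ S.viewHashes X τ v j

/-- A key under which the claim of the malicious player collides with `m`. -/
def Collides (X : Player) (m : Bits P.r) (τ : Strategy P) (v : View P) (k : Bits P.l) : Prop :=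
  S.viewClaim X m τ v ≠ m ∧ S.hash k (S.viewClaim X m τ v) = S.hash k m

theorem receivedHashes_other (X : Player) (m : Bits P.r) (τ : Strategy P) (K : KeyMaterial P) :
    receivedHashes K (S.received X m τ K) X.other = S.viewHashes X τ (S.view X m K) := rfl

/-- The announcements depend on the hidden set only through the result. After a success they are
determined by the view, and so is the claim. -/
theorem claimed_other {X : Player} {m : Bits P.r} {τ : Strategy P} {K : KeyMaterial P}
    (h : S.etResult K (S.received X m τ K) = true) :
    (S.claimed X m τ K X.other).1 = S.viewClaim X m τ (S.view X m K) := by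
  have hann : S.etAnnouncement K true = fun Y => S.sign ((if Y = X then (S.view X m K).2.1 else
      (S.view X m K).1.sc.mac) .etAnn) (encodeResult true) := by
    funext Y
    rcases X.eq_or_eq_other Y with rfl | rfl
    · simp [etAnnouncement, view]
    · simp [etAnnouncement, view, Player.other_ne]
  rw [claimed, h, hann]
  rfl

-- On the hidden set the keys agree, so success rules out deviations there. As `X` matches `m` at
-- all `N` indices, not prevailing means that the other player's claim matches the hashes of `X` at
-- least `N - |deviations|` times; all `n` hidden indices are conceded, and any further match is a
-- collision.
open Classical in
theorem avoid_and_collide_of_badUnforged {X : Player} {m : Bits P.r} {τ : Strategy P}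
    {K : KeyMaterial P} (h : S.BadUnforged X m τ K) :
    Disjoint K.hidden (S.deviations X m τ (S.view X m K)) ∧
      P.N ≤ P.n + (S.deviations X m τ (S.view X m K)).card +
        (K.hiddenᶜ.filter fun j => S.Collides X m τ (S.view X m K) ((K.key X).et j)).card := by
  obtain ⟨hbad, hu1, hu2⟩ := h
  obtain ⟨hres, -, harb⟩ := S.bad_iff.1 hbad
  have hsX := S.receivedHashes_etMessage K (S.received X m τ K) X m hu1
  have hsY := S.receivedHashes_other X m τ K
  have hmY := S.claimed_other hres
  have hkY : (S.view X m K).1 = K.key X.other := rfl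
  obtain ⟨hne, hprev⟩ := not_prevails_of_unfavorable S harb
  simp only [hu2, hmY] at hne
  constructor
  · rw [Finset.disjoint_left]
    intro j hj hjD
    refine (Finset.mem_filter.1 hjD).2 ?_
    have := (S.etResult_eq_true hres X).2 j hj
    rw [hsX, hsY] at this
    simpa only [hkY, K.agree X j hj] using this
  · have hXX : S.matchCount K (receivedHashes K (S.received X m τ K))
        (fun Y => (S.claimed X m τ K Y).1) X X = P.N := by
      simp [matchCount, hsX, hu2]
    have hYX : S.matchCount K (receivedHashes K (S.received X m τ K))
        (fun Y => (S.claimed X m τ K Y).1) X.other X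
        + (S.deviations X m τ (S.view X m K)).card = P.N := by
      simp only [matchCount, hsY, hu2, deviations, hkY]
      simpa using Finset.card_filter_add_card_filter_not (s := Finset.univ)
        fun j => S.hash ((K.key X.other).et j) m = S.viewHashes X τ (S.view X m K) j
    have hXY : S.matchCount K (receivedHashes K (S.received X m τ K))
        (fun Y => (S.claimed X m τ K Y).1) X X.other
        ≤ P.n + (K.hiddenᶜ.filter fun j =>
          S.Collides X m τ (S.view X m K) ((K.key X).et j)).card := by
      refine (Finset.card_le_card ?_).trans ((Finset.card_union_le K.hidden _).trans
        (Nat.add_le_add_right (le_of_eq K.2.1) _))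
      intro j hj
      simp only [hsX, hmY, Finset.mem_filter, Finset.mem_univ, true_and] at hj
      rw [Finset.mem_union]
      by_cases hjh : j ∈ K.hidden
      · exact Or.inl hjh
      · exact Or.inr (Finset.mem_filter.2
          ⟨Finset.mem_compl.2 hjh, fun h => hne h.symm, hj⟩)
    have := not_lt.1 fun h => hprev ⟨hXX, Or.inl h⟩
    omega

/-- The view, the hidden set and the equality-testing keys determine all keys. -/
theorem eq_of_view_eq {X : Player} {m : Bits P.r} {K K' : KeyMaterial P}
    (hv : S.view X m K = S.view X m K') (hΩ : K.hidden = K'.hidden)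
    (het : (K.key X).et = (K'.key X).et) : K = K' := by
  simp only [view, Prod.mk.injEq, etMessage, sign, het] at hv
  obtain ⟨h1, h2, h3⟩ := hv
  refine KeyMaterial.ext_keys X hΩ ?_ h1
  have hpad : (K.key X).sc.pad = (K'.key X).sc.pad := by
    funext i
    simpa [Bits.xor] using congrFun h3 i
  rcases hk : K.key X with ⟨_, _, _⟩
  rcases hk' : K'.key X with ⟨_, _, _⟩
  simp_all

/-- Every view is compatible with every hidden set and all equality-testing keys that agree with
those of the other player on the hidden set. -/
theorem exists_view_eq (X : Player) (m : Bits P.r) (v : View P) (Ω : Finset (Fin P.N))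
    (u : Fin P.N → Bits P.l) (h : Ω.card = P.n ∧ ∀ j ∈ Ω, u j = v.1.et j) :
    ∃ K : KeyMaterial P, S.view X m K = v ∧ K.hidden = Ω ∧ (K.key X).et = u := by
  -- The pad is solved for: it is the one that encrypts the hashes under `u` to the prescribed
  -- ciphertext.
  refine ⟨KeyMaterial.mk' X Ω
    ⟨u, ⟨Bits.xor v.2.2 (flatten fun j => S.hash (u j) m), v.2.1⟩⟩ v.1 h, ?_, rfl, by simp⟩
  refine Prod.ext (by simp [view]) (Prod.ext (by simp [view]) ?_)
  simp only [view, KeyMaterial.key_mk', etMessage, sign]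
  funext i
  simp [Bits.xor, Bool.xor_comm (v.2.2 i)]

open Classical in
theorem card_collides_le {δ : ℝ} (hδ : IsAlmostUniversal S.hash δ) (hδ0 : 0 ≤ δ) (X : Player)
    (m : Bits P.r) (τ : Strategy P) (v : View P) :
    ((Finset.univ.filter (S.Collides X m τ v)).card : ℝ) ≤ δ * Fintype.card (Bits P.l) := by
  unfold Collides
  by_cases h : S.viewClaim X m τ v = m
  · simp only [h, ne_eq, not_true_eq_false, false_and, Finset.filter_false,
      Finset.card_empty, Nat.cast_zero]
    positivity
  · have := hδ _ m h
    rw [div_le_iff₀ (by positivity)] at this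
    rw [card_bits]
    simpa [h] using this

-- Perfect secrecy of the pad: on each fiber of the view, the map to the hidden set and the hash
-- keys of `X` is a bijection onto the compatible pairs. Injectivity bounds the winning keys from
-- above, surjectivity bounds the fiber from below.
open Classical in
theorem card_badUnforged_le {δ : ℝ} (hδ : IsAlmostUniversal S.hash δ) (hδ0 : 0 ≤ δ)
    (hN : P.N = 2 * P.n) (X : Player) (m : Bits P.r) (τ : Strategy P) :
    ((Finset.univ.filter (S.BadUnforged X m τ)).card : ℝ)
      ≤ ((1 + δ) / 2) ^ P.n * Fintype.card (KeyMaterial P) := by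
  refine card_filter_le_of_fiberwise (S.view X m) _ _ fun v => ?_
  refine le_trans ?_ ((card_avoid_and_collide_le hN v.1.et (S.deviations X m τ v)
    (S.Collides X m τ v) δ (S.card_collides_le hδ hδ0 X m τ v)).trans ?_)
  · refine Nat.cast_le.2 (Finset.card_le_card_of_injOn
      (fun K : KeyMaterial P => (K.hidden, (K.key X).et)) ?_ ?_)
    · intro K hK
      simp only [Finset.coe_filter, Finset.mem_univ, true_and, Set.mem_ofPred_eq] at hK ⊢
      obtain ⟨rfl, hbad⟩ := hK
      obtain ⟨h1, h2⟩ := S.avoid_and_collide_of_badUnforged hbad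
      exact ⟨⟨K.2.1, K.agree X⟩, h1, by omega⟩
    · intro K hK K' hK' h
      simp only [Finset.coe_filter, Finset.mem_univ, true_and, Set.mem_ofPred_eq] at hK hK'
      simp only [Prod.mk.injEq] at h
      exact S.eq_of_view_eq (hK.1.trans hK'.1.symm) h.1 h.2
  · refine mul_le_mul_of_nonneg_left (Nat.cast_le.2 ?_) (by positivity)
    refine Finset.card_le_card_of_surjOn
      (fun K : KeyMaterial P => (K.hidden, (K.key X).et)) fun y hy => ?_
    simp only [Finset.coe_filter, Finset.mem_univ, true_and, Set.mem_ofPred_eq] at hy ⊢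
    obtain ⟨K, h1, h2, h3⟩ := S.exists_view_eq X m v y.1 y.2 hy
    exact ⟨K, h1, Prod.ext h2 h3⟩

/-! ### Union bound and randomized strategies -/

open Classical in
theorem card_bad_le {δh δe δd : ℝ} (hh : IsAlmostUniversal S.hash δh) (hδh : 0 ≤ δh)
    (he : IsSecureMAC (S.mac (P.N * P.l)) δe) (hd : IsSecureMAC (S.mac P.r) δd)
    (hN : P.N = 2 * P.n) (X : Player) (m : Bits P.r) (τ : Strategy P) :
    ((Finset.univ.filter (S.Bad X m τ)).card : ℝ)
      ≤ (δe + δd + ((1 + δh) / 2) ^ P.n) * Fintype.card (KeyMaterial P) := by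
  have hsub : Finset.univ.filter (S.Bad X m τ) ⊆ Finset.univ.filter (S.EtForged X m τ) ∪
      (Finset.univ.filter (S.DrForged X m τ) ∪ Finset.univ.filter (S.BadUnforged X m τ)) := by
    intro K hK
    simpa using S.forged_or_of_bad (Finset.mem_filter.1 hK).2
  have h1 := Finset.card_le_card hsub
  have h2 := h1.trans ((Finset.card_union_le _ _).trans
    (Nat.add_le_add_left (Finset.card_union_le _ _) _))
  have h3 : ((Finset.univ.filter (S.Bad X m τ)).card : ℝ)
      ≤ (Finset.univ.filter (S.EtForged X m τ)).card + ((Finset.univ.filter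
        (S.DrForged X m τ)).card + (Finset.univ.filter (S.BadUnforged X m τ)).card) := by
    exact_mod_cast h2
  have := S.card_etForged_le he X m τ
  have := S.card_drForged_le hd X m τ
  have := S.card_badUnforged_le hh hδh hN X m τ
  linarith

open Classical in
/-- It suffices to bound the number of keys under which a deterministic strategy wins. -/
theorem unmodifiable_of_card_bad_le {ε : ℝ} (h : ∀ X m τ,
    ((Finset.univ.filter (S.Bad X m τ)).card : ℝ) ≤ ε * Fintype.card (KeyMaterial P)) :
    S.Unmodifiable ε := by
  intro X m σ
  -- Strategy and keys are independent, so the strategy may be drawn first and the bound averaged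
  -- over it.
  have hswap : S.game X m σ = σ.bind fun τ => (keyDistribution P).map fun K => S.run X m K τ := by
    simp only [game, PMF.map]
    exact PMF.bind_comm _ _ _
  rw [hswap, PMF.toOuterMeasure_bind_apply]
  calc _ ≤ ∑' τ, σ τ * ENNReal.ofReal ε := by
        refine ENNReal.tsum_le_tsum fun τ => mul_le_mul_right ?_ _
        rw [PMF.toOuterMeasure_map_apply, keyDistribution,
          PMF.toOuterMeasure_uniformOfFintype_apply]
        have hpos : (0 : ℝ) < Fintype.card (KeyMaterial P) := by exact_mod_cast Fintype.card_pos
        refine ENNReal.div_le_of_le_mul ?_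
        rw [← ENNReal.ofReal_natCast (Fintype.card (KeyMaterial P)),
          ← ENNReal.ofReal_mul' hpos.le, ← ENNReal.ofReal_natCast]
        refine ENNReal.ofReal_le_ofReal (le_trans (le_of_eq ?_) (h X m τ))
        norm_cast
        rw [Fintype.card_subtype]
        rfl
    _ = ENNReal.ofReal ε := by rw [ENNReal.tsum_mul_right, PMF.tsum_coe, one_mul]

end Primitives

/-! ### Numerical estimates and conclusion -/

/-- Numerical bounds for the subset size. -/
theorem pow_le_of_eq_ceil {n : ℕ} {ε : ℝ} (hε0 : 0 < ε)
    (hn : n = ⌈3 * Real.logb 2 (16 / ε)⌉₊) :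
    (2 : ℝ)⁻¹ ^ n ≤ (ε / 16) ^ 3 ∧ ((3 : ℝ) / 4) ^ n ≤ ε / 16 := by
  have h1 : 3 * Real.logb 2 (16 / ε) ≤ n := by rw [hn]; exact Nat.le_ceil _
  have h2 : (16 / ε) ^ 3 ≤ (2 : ℝ) ^ n := by
    have h3 : Real.logb 2 ((16 / ε) ^ 3) ≤ n := by
      rw [Real.logb_pow]; exact_mod_cast h1
    have h4 := (Real.logb_le_iff_le_rpow (by norm_num) (by positivity)).1 h3
    exact_mod_cast h4
  have h5 : (2 : ℝ)⁻¹ ^ n ≤ (ε / 16) ^ 3 := by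
    rw [inv_pow, inv_le_comm₀ (by positivity) (by positivity), ← inv_pow, inv_div]
    exact h2
  -- Cubes are compared because `(3/4) ^ 3 = 27/64 ≤ 1/2`; this is what the factor 3 in `n` is for.
  refine ⟨h5, le_of_pow_le_pow_left₀ (n := 3) (by norm_num) (by positivity) (le_trans ?_ h5)⟩
  rw [← pow_mul, mul_comm, pow_mul]
  gcongr
  norm_num

theorem le_two_pow_of_eq_ceil_logb {r l : ℕ} (hr : 0 < r) (hl : l = ⌈Real.logb 2 (r : ℝ)⌉₊) :
    r ≤ 2 ^ l := by
  have h1 : Real.logb 2 (r : ℝ) ≤ l := by rw [hl]; exact Nat.le_ceil _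
  have h2 := (Real.logb_le_iff_le_rpow (by norm_num) (by positivity)).1 h1
  exact_mod_cast h2

theorem le_of_eq_ceil_logb {r l : ℕ} (hr : 0 < r) (hl : l = ⌈Real.logb 2 (r : ℝ)⌉₊) :
    l ≤ r := by
  rw [hl, Nat.ceil_le, Real.logb_le_iff_le_rpow (by norm_num) (by positivity)]
  exact_mod_cast Nat.lt_two_pow_self.le

theorem two_mul_le_two_pow {l : ℕ} (hl : 8 ≤ l) : 2 * l ≤ 2 ^ l := by
  induction l, hl using Nat.le_induction with
  | base => norm_num
  | succ l _ ih => rw [pow_succ]; omega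

/-- The ceiling is below `r / l ≤ 2 ^ l / 2`. The value `1/2` turns `(1 + δ) / 2` into `3/4`. -/
theorem hash_bound {r l : ℕ} (hl : 2 ≤ l) (hlr : l ≤ r) (hr : r ≤ 2 ^ l) :
    0 ≤ (⌈(r : ℝ) / l - 1⌉ : ℝ) * (2 : ℝ)⁻¹ ^ l ∧
      (⌈(r : ℝ) / l - 1⌉ : ℝ) * (2 : ℝ)⁻¹ ^ l ≤ 1 / 2 := by
  have hl0 : (0 : ℝ) < l := by exact_mod_cast (by omega : 0 < l)
  have h0 : (0 : ℝ) ≤ (r : ℝ) / l - 1 := by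
    rw [sub_nonneg, one_le_div hl0]; exact_mod_cast hlr
  refine ⟨mul_nonneg (by exact_mod_cast Int.ceil_nonneg h0) (by positivity), ?_⟩
  have h1 : (⌈(r : ℝ) / l - 1⌉ : ℝ) ≤ (2 : ℝ) ^ l / 2 := by
    refine (Int.ceil_lt_add_one _).le.trans ?_
    rw [sub_add_cancel]
    have : (r : ℝ) ≤ 2 ^ l := by exact_mod_cast hr
    exact div_le_div₀ (by positivity) this (by norm_num) (by exact_mod_cast hl)
  calc _ ≤ (2 : ℝ) ^ l / 2 * (2 : ℝ)⁻¹ ^ l := by gcongr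
    _ = 1 / 2 := by rw [inv_pow]; field_simp

/-- The `l` extra tag bits pay for the number of message blocks, at most `q ≤ 2 ^ l`. -/
theorem mac_bound {L n l q : ℕ} (hl : 0 < l) (hL : L ≤ (n + l) * q) (hq : q ≤ 2 ^ l) :
    (⌈(L : ℝ) / ((n : ℝ) + l)⌉ : ℝ) * (2 : ℝ)⁻¹ ^ (n + l) ≤ (2 : ℝ)⁻¹ ^ n := by
  have h1 : (⌈(L : ℝ) / ((n : ℝ) + l)⌉ : ℝ) ≤ (2 : ℝ) ^ l := by
    have h2 : ⌈(L : ℝ) / ((n : ℝ) + l)⌉ ≤ (q : ℤ) := by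
      rw [Int.ceil_le, div_le_iff₀ (by positivity), mul_comm]
      exact_mod_cast hL
    calc (⌈(L : ℝ) / ((n : ℝ) + l)⌉ : ℝ) ≤ ((q : ℤ) : ℝ) := by exact_mod_cast h2
      _ ≤ 2 ^ l := by exact_mod_cast hq
  calc _ ≤ (2 : ℝ) ^ l * (2 : ℝ)⁻¹ ^ (n + l) := by gcongr
    _ = _ := by rw [pow_add, inv_pow, inv_pow]; field_simp

theorem theorem1 (P : Params) (ε : ℝ) (hr : 256 ≤ P.r) (hε0 : 0 < ε) (hε : ε ≤ (2 : ℝ)⁻¹ ^ 4)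
    (hn : P.n = ⌈3 * Real.logb 2 (16 / ε)⌉₊) (hl : P.l = ⌈Real.logb 2 (P.r : ℝ)⌉₊)
    (hN : P.N = 2 * P.n) :
    (∃ S : Primitives P, S.Admissible) ∧
    (∀ S : Primitives P, S.Admissible →
      S.Secure ε ∧
      (∀ (K : KeyMaterial P) (m : Player → Bits P.r),
        S.etCommunication K m = 4 * (P.n * P.l + P.n + P.l + 1) ∧
        S.etCommunication K m ≤ 4 * (P.n * P.l + 2 * P.n + 2 * P.l + 1)) ∧
      (∀ (K : KeyMaterial P) (m m' : Player → Bits P.r),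
        S.drCommunication K m m' = 2 * (P.r + 2 * P.n + 2 * P.l + 2) ∧
        S.drCommunication K m m' ≤ 2 * (P.r + 4 * P.n + 4 * P.l + 2))) ∧
    (∀ K : KeyMaterial P,
      (K.key .A).scBits.length + (K.key .B).scBits.length
        = 4 * P.n * P.l + 16 * (P.n + P.l) ∧
      (K.key .A).etBits.length + (K.key .A).scBits.length
        + (K.key .B).etBits.length + (K.key .B).scBits.length
        = 8 * (P.n * P.l + 2 * P.n + 2 * P.l)) := by
  have hr2 : P.r ≤ 2 ^ P.l := le_two_pow_of_eq_ceil_logb (by omega) hl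
  have hlr : P.l ≤ P.r := le_of_eq_ceil_logb (by omega) hl
  have hl8 : 8 ≤ P.l :=
    (Nat.pow_le_pow_iff_right (by norm_num : 1 < 2)).1 ((by norm_num; omega : 2 ^ 8 ≤ 2 ^ P.l))
  obtain ⟨hn1, hn2⟩ := pow_le_of_eq_ceil hε0 hn
  refine ⟨exists_admissible P (by omega) hlr, fun S hS => ⟨⟨S.sound, ?_⟩, ?_, ?_⟩, ?_⟩
  · refine S.unmodifiable_of_card_bad_le fun X m τ => ?_
    obtain ⟨hb0, hb1⟩ := hash_bound (by omega) hlr hr2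
    refine (S.card_bad_le hS.1 hb0 (hS.2 _) (hS.2 _) hN X m τ).trans ?_
    -- The ciphertext has `2 * n * l ≤ (n + l) * (2 * l)` bits, hence `q = 2 * l`.
    have he := (mac_bound (L := P.N * P.l) (n := P.n) (q := 2 * P.l) (by omega : 0 < P.l)
      (by rw [hN]; nlinarith) (two_mul_le_two_pow hl8)).trans hn1
    have hd := (mac_bound (L := P.r) (n := P.n) (q := P.r) (by omega : 0 < P.l)
      (Nat.le_mul_of_pos_left _ (by omega)) hr2).trans hn1
    have hm : ((1 + (⌈(P.r : ℝ) / P.l - 1⌉ : ℝ) * (2 : ℝ)⁻¹ ^ P.l) / 2) ^ P.n ≤ ε / 16 :=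
      le_trans (pow_le_pow_left₀ (by positivity) (by linarith) _) hn2
    -- Each of the three failure terms is at most `ε / 16`, so their sum is well below `ε`.
    have h3 : (ε / 16) ^ 3 ≤ ε / 16 := pow_le_of_le_one (by positivity) (by linarith) (by norm_num)
    gcongr
    linarith
  · intro K m
    rw [S.etCommunication_eq hN]
    exact ⟨rfl, by omega⟩
  · intro K m m'
    rw [S.drCommunication_eq]
    exact ⟨rfl, by omega⟩
  · intro K
    simp only [PlayerKey.length_scBits, PlayerKey.length_etBits, hN]
    constructor <;> ring
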